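/- Let $S$ be a nonempty finite set and let $\mathcal B$ be a building set on $S$: a collection of nonempty subsets of $S$ that contains all singletons and such that $I\cup J\in\mathcal B$ whenever $I,J\in\mathcal B$ and $I\cap J\ne\emptyset$. Let $\mathcal B_{\max}$ be the set of inclusion-maximal elements of $\mathcal B$. A subset $N\subset\mathcal B-\mathcal B_{\max}$ is called nested if for any $k\ge 2$ and any $I_1,\dots,I_k\in N$ such that none of the $I_i$ contains another one, $I_1\cup\dots\cup I_k\notin\mathcal B$. For $I\subset S$ put $e_I=\sum_{i\in I}e_i\in\mathbb R^S$; let $V$ be the quotient of $\mathbb R^S$ by the linear span of the vectors $e_C$, $C\in\mathcal B_{\max}$, and let $\overline e_I$ be the image of $e_I$ in $V$. The nested fan $\Delta(\mathcal B)$ is the collection of the cones in $V$ generated by $\{\overline e_I: I\in N\}$, for all nested sets $N$. Identify the dual space $V^*$ with the space of real tuples $(x_i)_{i\in S}$ such that $\sum_{i\in C}x_i=0$ for all $C\in\mathcal B_{\max}$, via $x_i=\langle\overline e_{\{i\}},\varphi\rangle$ for $\varphi\in V^*$. For a full-dimensional simple convex polytope $\Pi\subset V^*$, its normal fan is the complete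 simplicial fan in $V$ formed by the cones $$\mathcal C_\Sigma=\{v\in V:\ \langle v,\varphi\rangle=\max_{\psi\in\Pi}\langle v,\psi\rangle\ \text{ for all }\varphi\in\Sigma\},$$ where $\Sigma$ runs over the nonempty faces of $\Pi$ (including $\Pi$ itself); the map $\Sigma\mapsto\mathcal C_\Sigma$ is an inclusion-reversing bijection from these faces to the cones of the fan, and the codimension of $\mathcal C_\Sigma$ equals $\dim\Sigma$. Theorem. The nested fan $\Delta(\mathcal B)$ is a complete simplicial fan, and it is the normal fan of a full-dimensional simple convex polytope $\Pi(\mathcal B)\subset V^*$ which, under the above identification, is the set of all tuples $(x_i)_{i\in S}$ of real numbers satisfying $$\sum_{i\in C}x_i=0\qquad(C\in\mathcal B_{\max}),$$ $$\sum_{i\in I}x_i\le |I|\,\bigl(2^{|C|-1}-2^{|I|-1}\bigr)\qquad(I\in\mathcal B-\mathcal B_{\max},\ I\subset C\in\mathcal B_{\max}).$$ -/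

import Mathlib

/-! ### Simplicial fans, simple polytopes and normal fans -/

section Fans

variable {V : Type*} [AddCommGroup V] [Module ℝ V]

/-- A complete simplicial fan in `V`: a finite collection of simplicial cones (each generated by
linearly independent vectors), closed under passing to faces, in which any two cones intersect
in a common face of both, and whose union is `V`. -/
structure IsCompleteSimplicialFan (Δ : Set (PointedCone ℝ V)) : Prop where
  finite : Δ.Finite
  simplicial : ∀ σ ∈ Δ, ∃ s : Finset V,
    LinearIndepOn ℝ id (s : Set V) ∧ σ = PointedCone.hull ℝ (s : Set V)
  face_mem : ∀ σ ∈ Δ, ∀ τ : PointedCone ℝ V, τ.IsFaceOf σ → τ ∈ Δ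
  inter_isFaceOf : ∀ σ ∈ Δ, ∀ τ ∈ Δ, (σ ⊓ τ).IsFaceOf σ ∧ (σ ⊓ τ).IsFaceOf τ
  complete : ∀ v : V, ∃ σ ∈ Δ, v ∈ σ

/-- `F` is a (nonempty) face of `P ⊆ V*`: the set of the points of `P` at which
some linear functional `φ ↦ ⟨v, φ⟩` attains its maximum on `P`
(for `v = 0` this is `P` itself). -/
def IsPolytopeFace (P F : Set (Module.Dual ℝ V)) : Prop :=
  F.Nonempty ∧ ∃ v : V, F = {φ | φ ∈ P ∧ ∀ ψ ∈ P, ψ v ≤ φ v}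

/-- The dimension of (the affine span of) a set. -/
noncomputable def affineDim (F : Set (Module.Dual ℝ V)) : ℕ :=
  Module.finrank ℝ (vectorSpan ℝ F)

/-- The facets of `P`, i.e. the faces of codimension one. -/
def IsPolytopeFacet (P F : Set (Module.Dual ℝ V)) : Prop :=
  IsPolytopeFace P F ∧ affineDim F + 1 = affineDim P

/-- A full-dimensional simple convex polytope in `V*`: the convex hull of a finite set, not
contained in a proper affine subspace, each of whose vertices lies in exactly `dim P` facets. -/
structure IsFullDimSimplePolytope (P : Set (Module.Dual ℝ V)) : Prop where
  polytope : ∃ s : Set (Module.Dual ℝ V), s.Finite ∧ P = convexHull ℝ s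
  full_dim : affineSpan ℝ P = ⊤
  simple : ∀ φ, IsPolytopeFace P {φ} →
    {F | IsPolytopeFacet P F ∧ φ ∈ F}.ncard = affineDim P

/-- For a face `F` of `P`, the cone of all `v` such that `⟨v, φ⟩`
equals the maximum of `⟨v, ·⟩` on `P` for every `φ ∈ F`. -/
def normalCone (P F : Set (Module.Dual ℝ V)) (hF : F ⊆ P) : PointedCone ℝ V where
  carrier := {v | ∀ φ ∈ F, IsGreatest ((fun ψ : Module.Dual ℝ V => ψ v) '' P) (φ v)}
  add_mem' := by
    intro v w hv hw φ hφ
    refine ⟨⟨φ, hF hφ, rfl⟩, ?_⟩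
    rintro _ ⟨ψ, hψ, rfl⟩
    simp only [map_add]
    exact add_le_add ((hv φ hφ).2 ⟨ψ, hψ, rfl⟩) ((hw φ hφ).2 ⟨ψ, hψ, rfl⟩)
  zero_mem' := by
    intro φ hφ
    refine ⟨⟨φ, hF hφ, rfl⟩, ?_⟩
    rintro _ ⟨ψ, hψ, rfl⟩
    simp
  smul_mem' := by
    intro c v hv φ hφ
    refine ⟨⟨φ, hF hφ, rfl⟩, ?_⟩
    rintro _ ⟨ψ, hψ, rfl⟩
    have h := (hv φ hφ).2 ⟨ψ, hψ, rfl⟩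
    have hc : (0 : ℝ) ≤ c := c.2
    have e : c • v = (c : ℝ) • v := rfl
    simp only [e, map_smul, smul_eq_mul]
    exact mul_le_mul_of_nonneg_left h hc

theorem IsPolytopeFace.subset {P F : Set (Module.Dual ℝ V)} (hF : IsPolytopeFace P F) :
    F ⊆ P := by
  obtain ⟨_, v, rfl⟩ := hF
  exact fun φ hφ => hφ.1

/-- The cone in `V` attached to a face of `P`. -/
def faceCone (P : Set (Module.Dual ℝ V)) (F : {F // IsPolytopeFace P F}) : PointedCone ℝ V :=
  normalCone P F.1 F.2.subset

/-- `Δ` is the normal fan of `P ⊆ V*`: it is a complete simplicial fan whose cones are exactly the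
cones attached to the faces of `P`, this correspondence is bijective and inclusion-reversing,
and the codimension of the cone of a face is the dimension of the face. -/
structure IsNormalFan (Δ : Set (PointedCone ℝ V)) (P : Set (Module.Dual ℝ V)) : Prop where
  fan : IsCompleteSimplicialFan Δ
  range_faceCone : Set.range (faceCone P) = Δ
  injective : Function.Injective (faceCone P)
  le_iff : ∀ F G : {F // IsPolytopeFace P F}, faceCone P F ≤ faceCone P G ↔ G.1 ⊆ F.1
  codim : ∀ F : {F // IsPolytopeFace P F},
    Module.finrank ℝ (Submodule.span ℝ (faceCone P F : Set V)) + affineDim F.1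
      = Module.finrank ℝ V

end Fans

/-! ### Building sets, nested sets and the nested fan -/

/-- A building set on `S`. -/
structure BuildingSet (S : Type*) [DecidableEq S] where
  sets : Set (Finset S)
  nonempty_of_mem : ∀ I ∈ sets, I.Nonempty
  union_mem : ∀ I ∈ sets, ∀ J ∈ sets, (I ∩ J).Nonempty → I ∪ J ∈ sets
  singleton_mem : ∀ i : S, {i} ∈ sets

namespace BuildingSet

variable {S : Type*} [DecidableEq S] (B : BuildingSet S)

/-- The `B`-components: the inclusion-maximal elements of `B`. -/
def components : Set (Finset S) := {C | Maximal (· ∈ B.sets) C}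

/-- `N` is nested: it consists of non-maximal elements of `B`, and the union of `k ≥ 2` elements
of `N`, none of which contains another one, is never in `B`. -/
def IsNested (N : Finset (Finset S)) : Prop :=
  (N : Set (Finset S)) ⊆ B.sets \ B.components ∧
    ∀ T ⊆ N, 2 ≤ T.card → IsAntichain (· ⊆ ·) (T : Set (Finset S)) → T.biUnion id ∉ B.sets

/-- The vector `e_I = ∑_{i ∈ I} e_i` in `ℝ^S`. -/
def indicatorVec (I : Finset S) : S → ℝ := ∑ i ∈ I, Pi.single i 1

/-- The linear span of the vectors `e_C`, for `C` a `B`-component. -/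
def componentSpan : Submodule ℝ (S → ℝ) := Submodule.span ℝ (indicatorVec '' B.components)

/-- The quotient `V` of `ℝ^S` by the span of the `e_C`, for `C` a `B`-component. -/
abbrev Ambient : Type _ := (S → ℝ) ⧸ B.componentSpan

/-- The image of `e_I` in `V`. -/
def ebar (I : Finset S) : B.Ambient := B.componentSpan.mkQ (indicatorVec I)

/-- The nested fan: the collection of the cones in `V` generated by the vectors `ebar I`, `I ∈ N`,
for all nested sets `N` (including the empty one). -/
def nestedFan : Set (PointedCone ℝ B.Ambient) :=
  {σ | ∃ N : Finset (Finset S), B.IsNested N ∧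
    σ = PointedCone.hull ℝ (B.ebar '' (N : Set (Finset S)))}

/-- The natural identification of `V*` with a space of real tuples: `φ ↦ (φ (ebar {i}))_{i ∈ S}`.
It is injective with range the tuples whose sum over every `B`-component vanishes;
see `tuple_injective` and `mem_range_tuple`. -/
def tuple : Module.Dual ℝ B.Ambient →ₗ[ℝ] (S → ℝ) where
  toFun φ i := φ (B.ebar {i})
  map_add' _ _ := rfl
  map_smul' _ _ := rfl

theorem tuple_injective [Fintype S] : Function.Injective B.tuple := by
  intro φ ψ h
  apply Submodule.linearMap_qext
  apply LinearMap.pi_ext'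
  intro i
  apply LinearMap.ext_ring
  have := congrFun h i
  simpa [tuple, ebar, indicatorVec] using this

theorem mem_range_tuple [Fintype S] (x : S → ℝ) :
    x ∈ LinearMap.range B.tuple ↔ ∀ C ∈ B.components, ∑ i ∈ C, x i = 0 := by
  constructor
  · rintro ⟨φ, rfl⟩ C hC
    have h : ∑ i ∈ C, B.tuple φ i = φ (B.ebar C) := by
      simp [tuple, ebar, indicatorVec, map_sum]
    have h0 : B.ebar C = 0 := by
      rw [ebar, Submodule.mkQ_apply, Submodule.Quotient.mk_eq_zero]
      exact Submodule.subset_span ⟨C, hC, rfl⟩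
    rw [h, h0, map_zero]
  · intro hx
    let f : (S → ℝ) →ₗ[ℝ] ℝ := Fintype.linearCombination ℝ x
    have hs : ∀ i, f (Pi.single i 1) = x i := fun i => by
      simp [f, Fintype.linearCombination_apply, Pi.single_apply]
    refine ⟨B.componentSpan.liftQ f ?_, ?_⟩
    · rw [componentSpan, Submodule.span_le]
      rintro _ ⟨C, hC, rfl⟩
      simp only [SetLike.mem_coe, LinearMap.mem_ker, indicatorVec, map_sum, hs]
      exact hx C hC
    · funext i
      simp [tuple, ebar, indicatorVec, hs]

end BuildingSet

/-!
The polytope is studied through the following criterion, which needs no combinatorics of building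
sets. Let `P ⊆ V*` be cut out by finitely many inequalities `⟨e I, φ⟩ ≤ h I`, and let `𝒩` be a
collection of sets of indices such that

* every `v ∈ V` is a positive combination of the `e I`, `I ∈ N`, for some `N ∈ 𝒩`;
* every `N ∈ 𝒩` is the exact set of inequalities tight at some point of `P`;
* inequalities that are simultaneously tight at a point of `P` form a member of `𝒩`.

This is `IsTightComplex`. By complementary slackness (`IsTightComplex.maximizers_eq`), a positive
combination of the `e I`, `I ∈ N`, is maximal on `P` exactly on the face where the inequalities of
`N` are tight, so faces, their normal cones and the members of `𝒩` determine each other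
(`IsTightComplex.isNormalFan`). Differences of points with prescribed tight sets yield functionals
showing that the cones are simplicial (`IsTightComplex.linearIndepOn`) and that they meet in faces
(`IsTightComplex.hull_isFaceOf_hull`). As the maximum of every `v` is attained at one of finitely
many chosen points, `P` is their convex hull (`IsTightComplex.isPolytope`).

For a building set, substituting `y i = 2 ^ (|C| - 1) - x i` for `i` in the component `C` turns the
inequalities into `growth |I| ≤ ∑ i ∈ I, y i`, with `growth n = n * 2 ^ (n - 1)`, and equality for
the components. The three conditions are then checked as follows.

* A nonnegative function on `S` is peeled from below: its least positive value times the indicator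
  of its support is split among the components of the support, and the union of all sets produced
  in this way is nested (`BuildingSet.exists_nestedFamily_comb`).
* For a nested set, a weight that is tight exactly there is built from the inside out, by sharing
  the remaining weight of each `I` equally among the points of `I` that lie in no smaller member
  (`BuildingSet.IsNestedFamily.exists_weight`).
* Sets tight at a common point can neither cross nor be disjoint with union in the building set
  (`BuildingSet.biUnion_notMem_of_tight`).

The last two rest only on the fast growth `2 ^ k * growth m < growth (m + k)` for `k > 0`.
-/

/-! ### Polyhedra whose tight sets form a given complex -/

section TightSets

variable {V ι : Type*} [AddCommGroup V] [Module ℝ V]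

/-- The polyhedron in `V*` cut out by the inequalities `⟨e I, φ⟩ ≤ h I` for `I ∈ E`. -/
def polyhedron (E : Set ι) (e : ι → V) (h : ι → ℝ) : Set (Module.Dual ℝ V) :=
  {φ | ∀ I ∈ E, φ (e I) ≤ h I}

/-- The part of the polyhedron on which the inequalities indexed by `N` are equalities. -/
def tightFace (E : Set ι) (e : ι → V) (h : ι → ℝ) (N : Finset ι) : Set (Module.Dual ℝ V) :=
  {φ | φ ∈ polyhedron E e h ∧ ∀ I ∈ N, φ (e I) = h I}

/-- The sets in `𝒩` are exactly the sets of inequalities that are simultaneously tight at some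
point of the polyhedron (each of them is even the full tight set of some point), and every vector
is a positive combination of the `e I`, with `I` running over some member of `𝒩`. -/
structure IsTightComplex (E : Set ι) (e : ι → V) (h : ι → ℝ) (𝒩 : Set (Finset ι)) : Prop where
  finite : E.Finite
  subset : ∀ N ∈ 𝒩, (N : Set ι) ⊆ E
  exists_comb : ∀ v : V, ∃ N ∈ 𝒩, ∃ c : ι → ℝ, (∀ I ∈ N, 0 < c I) ∧ v = ∑ I ∈ N, c I • e I
  exists_tight : ∀ N ∈ 𝒩, ∃ φ ∈ polyhedron E e h, ∀ I ∈ E, φ (e I) = h I ↔ I ∈ N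
  mem_of_tight : ∀ φ ∈ polyhedron E e h, ∀ N : Finset ι, (N : Set ι) ⊆ E →
    (∀ I ∈ N, φ (e I) = h I) → N ∈ 𝒩

theorem convex_polyhedron (E : Set ι) (e : ι → V) (h : ι → ℝ) : Convex ℝ (polyhedron E e h) := by
  intro φ hφ ψ hψ a b ha hb hab I hI
  simp only [LinearMap.add_apply, LinearMap.smul_apply, smul_eq_mul]
  have h1 := mul_le_mul_of_nonneg_left (hφ I hI) ha
  have h2 := mul_le_mul_of_nonneg_left (hψ I hI) hb
  calc _ ≤ a * h I + b * h I := add_le_add h1 h2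
    _ = h I := by rw [← add_mul, hab, one_mul]

theorem tightFace_empty (E : Set ι) (e : ι → V) (h : ι → ℝ) :
    tightFace E e h ∅ = polyhedron E e h := by
  ext φ; simp [tightFace]

theorem tightFace_subset (E : Set ι) (e : ι → V) (h : ι → ℝ) (N : Finset ι) :
    tightFace E e h N ⊆ polyhedron E e h := fun _ hφ => hφ.1

theorem tightFace_anti (E : Set ι) (e : ι → V) (h : ι → ℝ) {M N : Finset ι} (hMN : M ⊆ N) :
    tightFace E e h N ⊆ tightFace E e h M := fun _ hφ => ⟨hφ.1, fun I hI => hφ.2 I (hMN hI)⟩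

theorem exists_pos_comb_of_mem_hull {e : ι → V} {N : Finset ι} {v : V}
    (hv : v ∈ PointedCone.hull ℝ (e '' (N : Set ι))) :
    ∃ M ⊆ N, ∃ c : ι → ℝ, (∀ I ∈ M, 0 < c I) ∧ v = ∑ I ∈ M, c I • e I := by
  classical
  obtain ⟨c, rfl⟩ := Submodule.mem_span_image_finset_iff_exists_fun' _ |>.1 hv
  refine ⟨N.filter (fun I => c I ≠ 0), Finset.filter_subset _ _, fun I => c I, ?_, ?_⟩
  · intro I hI
    have h1 := (Finset.mem_filter.1 hI).2
    exact lt_of_le_of_ne (c I).2 (fun h => h1 (Subtype.ext h.symm))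
  · rw [Finset.sum_filter]
    refine Finset.sum_congr rfl fun I _ => ?_
    split_ifs with h0
    · rfl
    · rw [not_not.1 h0, zero_smul]

theorem sum_smul_mem_hull {e : ι → V} {M N : Finset ι} (hMN : M ⊆ N) {c : ι → ℝ}
    (hc : ∀ I ∈ M, 0 < c I) :
    ∑ I ∈ M, c I • e I ∈ PointedCone.hull ℝ (e '' (N : Set ι)) :=
  Submodule.sum_mem _ fun I hI => PointedCone.smul_mem _ (hc I hI).le
    (PointedCone.subset_hull ⟨I, hMN hI, rfl⟩)

/-- A face of the cone generated by the `e I`, `I ∈ N`, is generated by those `e I` that it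
contains. -/
theorem eq_hull_of_isFaceOf_hull {e : ι → V} {N : Finset ι} {τ : PointedCone ℝ V}
    (hτ : τ.IsFaceOf (PointedCone.hull ℝ (e '' (N : Set ι)))) :
    ∃ M ⊆ N, τ = PointedCone.hull ℝ (e '' (M : Set ι)) := by
  classical
  refine ⟨N.filter (fun I => e I ∈ τ), Finset.filter_subset _ _, le_antisymm ?_ ?_⟩
  · intro v hv
    obtain ⟨K, hK, c, hc, rfl⟩ := exists_pos_comb_of_mem_hull (hτ.le hv)
    refine sum_smul_mem_hull (fun I hI => Finset.mem_filter.2 ⟨hK hI, ?_⟩) hc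
    rw [← Finset.add_sum_erase K _ hI] at hv
    exact hτ.mem_of_smul_add_mem (PointedCone.subset_hull ⟨I, hK hI, rfl⟩)
      (sum_smul_mem_hull ((K.erase_subset I).trans hK)
        fun J hJ => hc J (Finset.mem_of_mem_erase hJ)) (hc I hI) hv
  · refine Submodule.span_le.2 ?_
    rintro _ ⟨I, hI, rfl⟩
    exact (Finset.mem_filter.1 hI).2

namespace IsTightComplex

variable {E : Set ι} {e : ι → V} {h : ι → ℝ} {𝒩 : Set (Finset ι)}

theorem mem_of_subset (H : IsTightComplex E e h 𝒩) {M N : Finset ι} (hN : N ∈ 𝒩) (hMN : M ⊆ N) :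
    M ∈ 𝒩 := by
  obtain ⟨φ, hφ, ht⟩ := H.exists_tight N hN
  have hE : (M : Set ι) ⊆ E := fun I hI => H.subset N hN (hMN hI)
  exact H.mem_of_tight φ hφ M hE fun I hI => (ht I (hE hI)).2 (hMN hI)

theorem tightFace_nonempty (H : IsTightComplex E e h 𝒩) {N : Finset ι} (hN : N ∈ 𝒩) :
    (tightFace E e h N).Nonempty := by
  obtain ⟨φ, hφ, ht⟩ := H.exists_tight N hN
  exact ⟨φ, hφ, fun I hI => (ht I (H.subset N hN hI)).2 hI⟩

theorem empty_mem (H : IsTightComplex E e h 𝒩) : ∅ ∈ 𝒩 := by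
  obtain ⟨N, hN, -⟩ := H.exists_comb 0
  exact H.mem_of_subset hN (Finset.empty_subset N)

theorem tightFace_subset_iff (H : IsTightComplex E e h 𝒩) {M N : Finset ι} (hM : M ∈ 𝒩)
    (hN : N ∈ 𝒩) : tightFace E e h N ⊆ tightFace E e h M ↔ M ⊆ N := by
  refine ⟨fun hs I hI => ?_, tightFace_anti E e h⟩
  obtain ⟨φ, hφ, ht⟩ := H.exists_tight N hN
  have h1 : φ ∈ tightFace E e h M := hs ⟨hφ, fun I hI => (ht I (H.subset N hN hI)).2 hI⟩
  exact (ht I (H.subset M hM hI)).1 (h1.2 I hI)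

theorem tightFace_inj (H : IsTightComplex E e h 𝒩) {M N : Finset ι} (hM : M ∈ 𝒩)
    (hN : N ∈ 𝒩) (hMN : tightFace E e h M = tightFace E e h N) : M = N :=
  ((H.tightFace_subset_iff hM hN).1 hMN.ge).antisymm ((H.tightFace_subset_iff hN hM).1 hMN.le)

/-- Complementary slackness: a positive combination of the `e I`, `I ∈ N`, is maximal on the
polyhedron exactly where the inequalities indexed by `N` are tight. -/
theorem maximizers_eq (H : IsTightComplex E e h 𝒩) {N : Finset ι} (hN : N ∈ 𝒩) {c : ι → ℝ}
    (hc : ∀ I ∈ N, 0 < c I) :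
    {φ | φ ∈ polyhedron E e h ∧ ∀ ψ ∈ polyhedron E e h,
      ψ (∑ I ∈ N, c I • e I) ≤ φ (∑ I ∈ N, c I • e I)} = tightFace E e h N := by
  have hle : ∀ ψ ∈ polyhedron E e h, ∀ I ∈ N, c I * ψ (e I) ≤ c I * h I := fun ψ hψ I hI =>
    mul_le_mul_of_nonneg_left (hψ I (H.subset N hN hI)) (hc I hI).le
  have heval : ∀ ψ : Module.Dual ℝ V, ψ (∑ I ∈ N, c I • e I) = ∑ I ∈ N, c I * ψ (e I) := by
    intro ψ; simp [map_sum]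
  obtain ⟨φ₀, hφ₀⟩ := H.tightFace_nonempty hN
  have h0 : φ₀ (∑ I ∈ N, c I • e I) = ∑ I ∈ N, c I * h I := by
    rw [heval]; exact Finset.sum_congr rfl fun I hI => by rw [hφ₀.2 I hI]
  ext φ
  constructor
  · rintro ⟨hφ, hmax⟩
    refine ⟨hφ, fun I hI => ?_⟩
    have h1 := hmax φ₀ hφ₀.1
    rw [h0, heval] at h1
    have h2 := (Finset.sum_eq_sum_iff_of_le (hle φ hφ)).1
      (le_antisymm (Finset.sum_le_sum (hle φ hφ)) h1) I hI
    exact mul_left_cancel₀ (hc I hI).ne' h2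
  · rintro ⟨hφ, ht⟩
    refine ⟨hφ, fun ψ hψ => ?_⟩
    rw [heval, heval]
    refine Finset.sum_le_sum fun I hI => ?_
    rw [ht I hI]
    exact hle ψ hψ I hI

theorem isPolytopeFace_iff (H : IsTightComplex E e h 𝒩) {F : Set (Module.Dual ℝ V)} :
    IsPolytopeFace (polyhedron E e h) F ↔ ∃ N ∈ 𝒩, F = tightFace E e h N := by
  constructor
  · rintro ⟨-, v, rfl⟩
    obtain ⟨N, hN, c, hc, rfl⟩ := H.exists_comb v
    exact ⟨N, hN, H.maximizers_eq hN hc⟩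
  · rintro ⟨N, hN, rfl⟩
    exact ⟨H.tightFace_nonempty hN, ∑ I ∈ N, (1 : ℝ) • e I,
      (H.maximizers_eq hN (c := fun _ => 1) fun _ _ => one_pos).symm⟩

/-- The support of a positive combination over `𝒩` is determined by its value. -/
theorem support_unique (H : IsTightComplex E e h 𝒩) {M N : Finset ι} (hM : M ∈ 𝒩) (hN : N ∈ 𝒩)
    {b c : ι → ℝ} (hb : ∀ I ∈ M, 0 < b I) (hc : ∀ I ∈ N, 0 < c I)
    (hbc : ∑ I ∈ M, b I • e I = ∑ I ∈ N, c I • e I) : M = N := by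
  refine H.tightFace_inj hM hN ?_
  rw [← H.maximizers_eq hM hb, ← H.maximizers_eq hN hc, hbc]

theorem hull_le_iff (H : IsTightComplex E e h 𝒩) {M N : Finset ι} (hM : M ∈ 𝒩) (hN : N ∈ 𝒩) :
    PointedCone.hull ℝ (e '' (N : Set ι)) ≤ PointedCone.hull ℝ (e '' (M : Set ι)) ↔ N ⊆ M := by
  refine ⟨fun hle => ?_, fun hs => Submodule.span_mono (Set.image_mono (by exact_mod_cast hs))⟩
  obtain ⟨K, hK, c, hc, hv⟩ := exists_pos_comb_of_mem_hull
    (hle (sum_smul_mem_hull (Finset.Subset.refl N) (c := fun _ => (1 : ℝ)) fun _ _ => one_pos))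
  rwa [H.support_unique hN (H.mem_of_subset hM hK) (fun _ _ => one_pos) hc hv]

theorem normalCone_tightFace (H : IsTightComplex E e h 𝒩) {N : Finset ι} (hN : N ∈ 𝒩) :
    normalCone (polyhedron E e h) (tightFace E e h N) (tightFace_subset E e h N)
      = PointedCone.hull ℝ (e '' (N : Set ι)) := by
  have key : ∀ v, v ∈ normalCone (polyhedron E e h) (tightFace E e h N)
      (tightFace_subset E e h N) ↔ tightFace E e h N ⊆
        {φ | φ ∈ polyhedron E e h ∧ ∀ ψ ∈ polyhedron E e h, ψ v ≤ φ v} := by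
    intro v
    constructor
    · exact fun hv φ hφ => ⟨hφ.1, fun ψ hψ => (hv φ hφ).2 ⟨ψ, hψ, rfl⟩⟩
    · intro hv φ hφ
      refine ⟨⟨φ, hφ.1, rfl⟩, ?_⟩
      rintro _ ⟨ψ, hψ, rfl⟩
      exact (hv hφ).2 ψ hψ
  ext v
  rw [key]
  constructor
  · intro hv
    obtain ⟨M, hM, c, hc, rfl⟩ := H.exists_comb v
    rw [H.maximizers_eq hM hc, H.tightFace_subset_iff hM hN] at hv
    exact sum_smul_mem_hull hv hc
  · intro hv
    obtain ⟨M, hMN, c, hc, rfl⟩ := exists_pos_comb_of_mem_hull hv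
    rw [H.maximizers_eq (H.mem_of_subset hN hMN) hc]
    exact tightFace_anti E e h hMN

/-- The linear independence is witnessed by differences of points of the polyhedron: subtracting
from a point with tight set `N` a point with tight set `N \ {I}` gives a functional that vanishes
on `e J` for `J ∈ N \ {I}` but not on `e I`. -/
theorem linearIndepOn (H : IsTightComplex E e h 𝒩) {N : Finset ι} (hN : N ∈ 𝒩) :
    LinearIndepOn ℝ e (N : Set ι) := by
  classical
  rw [linearIndepOn_finset_iff]
  intro g hg I hI
  obtain ⟨φ, hφ, ht⟩ := H.exists_tight N hN
  obtain ⟨ψ, hψ, hs⟩ := H.exists_tight _ (H.mem_of_subset hN (N.erase_subset I))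
  have hE := H.subset N hN
  have h1 : ∑ J ∈ N, g J * (φ - ψ) (e J) = 0 := by
    have := congrArg (φ - ψ) hg
    simpa only [map_sum, map_smul, smul_eq_mul, map_zero] using this
  rw [Finset.sum_eq_single_of_mem I hI] at h1
  · refine (mul_eq_zero.1 h1).resolve_right fun h2 => ?_
    have h3 : ψ (e I) = h I := by
      rw [← (ht I (hE hI)).2 hI]; exact (sub_eq_zero.1 h2).symm
    exact Finset.notMem_erase I N ((hs I (hE hI)).1 h3)
  · intro J hJ hJI
    rw [LinearMap.sub_apply, (ht J (hE hJ)).2 hJ,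
      (hs J (hE hJ)).2 (Finset.mem_erase.2 ⟨hJI, hJ⟩), sub_self, mul_zero]

theorem finrank_span_hull (H : IsTightComplex E e h 𝒩) {N : Finset ι} (hN : N ∈ 𝒩) :
    Module.finrank ℝ (Submodule.span ℝ
      (PointedCone.hull ℝ (e '' (N : Set ι)) : Set V)) = N.card := by
  classical
  have hspan : Submodule.span ℝ (PointedCone.hull ℝ (e '' (N : Set ι)) : Set V)
      = Submodule.span ℝ (e '' (N : Set ι)) :=
    le_antisymm (Submodule.span_le.2 (PointedCone.hull_le_span ℝ _))
      (Submodule.span_mono PointedCone.subset_hull)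
  rw [hspan, Set.image_eq_range, finrank_span_eq_card (H.linearIndepOn hN)]
  simp

/-- At a point whose tight set is exactly `N`, every direction annihilating the `e I`, `I ∈ N`,
can be followed for a positive time without leaving the polyhedron. -/
theorem vectorSpan_tightFace (H : IsTightComplex E e h 𝒩) {N : Finset ι} (hN : N ∈ 𝒩) :
    vectorSpan ℝ (tightFace E e h N)
      = (Submodule.span ℝ (e '' (N : Set ι))).dualAnnihilator := by
  apply le_antisymm
  · rw [vectorSpan, Submodule.span_le]
    rintro _ ⟨φ, hφ, ψ, hψ, rfl⟩
    rw [SetLike.mem_coe, Submodule.mem_dualAnnihilator]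
    intro v hv
    induction hv using Submodule.span_induction with
    | mem x hx =>
      obtain ⟨I, hI, rfl⟩ := hx
      change φ (e I) - ψ (e I) = 0
      rw [hφ.2 I hI, hψ.2 I hI, sub_self]
    | zero => exact map_zero _
    | add x y _ _ hx hy => rw [map_add, hx, hy, add_zero]
    | smul a x _ hx => rw [map_smul, hx, smul_zero]
  · intro δ hδ
    rw [Submodule.mem_dualAnnihilator] at hδ
    have hδN : ∀ I ∈ N, δ (e I) = 0 := fun I hI => hδ _ (Submodule.subset_span ⟨I, hI, rfl⟩)
    obtain ⟨φ, hφ, ht⟩ := H.exists_tight N hN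
    have hev : ∀ᶠ t : ℝ in nhdsWithin 0 (Set.Ioi 0), ∀ I ∈ E, (φ + t • δ) (e I) ≤ h I := by
      rw [Filter.eventually_all_finite H.finite]
      intro I hI
      by_cases hIN : I ∈ N
      · filter_upwards with t
        simp [hδN I hIN, hφ I hI]
      · have hlt : φ (e I) < h I := lt_of_le_of_ne (hφ I hI) fun h1 => hIN ((ht I hI).1 h1)
        have hcont : Continuous fun t : ℝ => (φ + t • δ) (e I) := by
          simp only [LinearMap.add_apply, LinearMap.smul_apply, smul_eq_mul]
          fun_prop
        have h0 : (fun t : ℝ => (φ + t • δ) (e I)) 0 < h I := by simpa using hlt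
        filter_upwards [(hcont.continuousAt.eventually_lt_const h0).filter_mono
          nhdsWithin_le_nhds] with t ht' using ht'.le
    obtain ⟨t, htP, ht0⟩ := (hev.and self_mem_nhdsWithin).exists
    have hφF : φ ∈ tightFace E e h N := ⟨hφ, fun I hI => (ht I (H.subset N hN hI)).2 hI⟩
    have htF : φ + t • δ ∈ tightFace E e h N :=
      ⟨htP, fun I hI => by simp [hδN I hI, hφF.2 I hI]⟩
    have := vsub_mem_vectorSpan ℝ htF hφF
    rw [vsub_eq_sub, add_sub_cancel_left] at this
    exact (Submodule.smul_mem_iff _ (ne_of_gt ht0)).1 this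

theorem card_add_affineDim (H : IsTightComplex E e h 𝒩) [FiniteDimensional ℝ V] {N : Finset ι}
    (hN : N ∈ 𝒩) : N.card + affineDim (tightFace E e h N) = Module.finrank ℝ V := by
  classical
  rw [affineDim, H.vectorSpan_tightFace hN,
    ← Subspace.finrank_add_finrank_dualAnnihilator_eq (Submodule.span ℝ (e '' (N : Set ι)))]
  congr 1
  rw [Set.image_eq_range, finrank_span_eq_card (H.linearIndepOn hN)]
  simp

theorem affineDim_polyhedron (H : IsTightComplex E e h 𝒩) [FiniteDimensional ℝ V] :
    affineDim (polyhedron E e h) = Module.finrank ℝ V := by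
  rw [← tightFace_empty, ← H.card_add_affineDim H.empty_mem, Finset.card_empty, zero_add]

/-- The cone over `M ⊆ N` is cut out of the cone over `N` by a supporting functional, the
difference of points with tight sets `N` and `M`. -/
theorem hull_isFaceOf_hull (H : IsTightComplex E e h 𝒩) {M N : Finset ι} (hN : N ∈ 𝒩)
    (hMN : M ⊆ N) :
    (PointedCone.hull ℝ (e '' (M : Set ι))).IsFaceOf
      (PointedCone.hull ℝ (e '' (N : Set ι))) := by
  have hM := H.mem_of_subset hN hMN
  obtain ⟨φ, hφ, ht⟩ := H.exists_tight N hN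
  obtain ⟨ψ, hψ, hs⟩ := H.exists_tight M hM
  have hE := H.subset N hN
  have hpos : ∀ I ∈ N, 0 ≤ (φ - ψ) (e I) := fun I hI => by
    rw [LinearMap.sub_apply, (ht I (hE hI)).2 hI]
    exact sub_nonneg.2 (hψ I (hE hI))
  have hval : ∀ K : Finset ι, ∀ c : ι → ℝ,
      (φ - ψ) (∑ I ∈ K, c I • e I) = ∑ I ∈ K, c I * (φ - ψ) (e I) := fun K c => by
    simp only [map_sum, map_smul, smul_eq_mul]
  have hnonneg : ∀ v ∈ PointedCone.hull ℝ (e '' (N : Set ι)), 0 ≤ (φ - ψ) v := by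
    intro v hv
    obtain ⟨K, hK, c, hc, rfl⟩ := exists_pos_comb_of_mem_hull hv
    rw [hval]
    exact Finset.sum_nonneg fun I hI => mul_nonneg (hc I hI).le (hpos I (hK hI))
  have hzero : ∀ v ∈ PointedCone.hull ℝ (e '' (M : Set ι)), (φ - ψ) v = 0 := by
    intro v hv
    obtain ⟨K, hK, c, hc, rfl⟩ := exists_pos_comb_of_mem_hull hv
    rw [hval]
    refine Finset.sum_eq_zero fun I hI => ?_
    have hIE := hE (hMN (hK hI))
    rw [LinearMap.sub_apply, (ht I hIE).2 (hMN (hK hI)), (hs I hIE).2 (hK hI), sub_self, mul_zero]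
  refine ⟨(H.hull_le_iff hN hM).2 hMN, fun {x y a} hx hy ha hxy => ?_⟩
  have h1 := hzero _ hxy
  rw [map_add, map_smul, smul_eq_mul] at h1
  have hx0 : (φ - ψ) x = 0 := by
    have h2 := hnonneg x hx
    have h3 := hnonneg y hy
    nlinarith [mul_nonneg ha.le h2]
  obtain ⟨K, hK, c, hc, rfl⟩ := exists_pos_comb_of_mem_hull hx
  refine sum_smul_mem_hull (fun I hI => ?_) hc
  rw [hval, Finset.sum_eq_zero_iff_of_nonneg
    fun I hI => mul_nonneg (hc I hI).le (hpos I (hK hI))] at hx0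
  have h4 := (mul_eq_zero.1 (hx0 I hI)).resolve_left (hc I hI).ne'
  rw [LinearMap.sub_apply, (ht I (hE (hK hI))).2 (hK hI), sub_eq_zero] at h4
  exact (hs I (hE (hK hI))).1 h4.symm

theorem inf_hull [DecidableEq ι] (H : IsTightComplex E e h 𝒩) {M N : Finset ι} (hM : M ∈ 𝒩)
    (hN : N ∈ 𝒩) :
    PointedCone.hull ℝ (e '' (M : Set ι)) ⊓ PointedCone.hull ℝ (e '' (N : Set ι))
      = PointedCone.hull ℝ (e '' ((M ∩ N : Finset ι) : Set ι)) := by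
  have hMN := H.mem_of_subset hM (Finset.inter_subset_left (s₂ := N))
  refine le_antisymm ?_ (le_inf ((H.hull_le_iff hM hMN).2 Finset.inter_subset_left)
    ((H.hull_le_iff hN hMN).2 Finset.inter_subset_right))
  rintro v ⟨hvM, hvN⟩
  obtain ⟨K, hK, c, hc, rfl⟩ := exists_pos_comb_of_mem_hull hvM
  obtain ⟨L, hL, b, hb, hKL⟩ := exists_pos_comb_of_mem_hull hvN
  have hKeq := H.support_unique (H.mem_of_subset hM hK) (H.mem_of_subset hN hL) hc hb hKL
  exact sum_smul_mem_hull (Finset.subset_inter hK (hKeq ▸ hL)) hc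

theorem finite_complex (H : IsTightComplex E e h 𝒩) : 𝒩.Finite :=
  (H.finite.toFinset.powerset.finite_toSet).subset fun N hN => by
    rw [Finset.mem_coe, Finset.mem_powerset, ← Finset.coe_subset, H.finite.coe_toFinset]
    exact H.subset N hN

theorem isCompleteSimplicialFan (H : IsTightComplex E e h 𝒩) :
    IsCompleteSimplicialFan {σ | ∃ N ∈ 𝒩, σ = PointedCone.hull ℝ (e '' (N : Set ι))} where
  finite := by
    refine (H.finite_complex.image
      fun N : Finset ι => PointedCone.hull ℝ (e '' (N : Set ι))).subset ?_
    rintro _ ⟨N, hN, rfl⟩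
    exact ⟨N, hN, rfl⟩
  simplicial := by
    classical
    rintro _ ⟨N, hN, rfl⟩
    refine ⟨N.image e, ?_, by rw [Finset.coe_image]⟩
    rw [Finset.coe_image]
    exact (H.linearIndepOn hN).id_image
  face_mem := by
    rintro _ ⟨N, hN, rfl⟩ τ hτ
    obtain ⟨M, hMN, rfl⟩ := eq_hull_of_isFaceOf_hull hτ
    exact ⟨M, H.mem_of_subset hN hMN, rfl⟩
  inter_isFaceOf := by
    classical
    rintro _ ⟨N, hN, rfl⟩ _ ⟨M, hM, rfl⟩
    rw [H.inf_hull hN hM]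
    exact ⟨H.hull_isFaceOf_hull hN Finset.inter_subset_left,
      H.hull_isFaceOf_hull hM Finset.inter_subset_right⟩
  complete := by
    intro v
    obtain ⟨N, hN, c, hc, rfl⟩ := H.exists_comb v
    exact ⟨_, ⟨N, hN, rfl⟩, sum_smul_mem_hull (Finset.Subset.refl N) hc⟩

theorem isNormalFan (H : IsTightComplex E e h 𝒩) [FiniteDimensional ℝ V] :
    IsNormalFan {σ | ∃ N ∈ 𝒩, σ = PointedCone.hull ℝ (e '' (N : Set ι))}
      (polyhedron E e h) := by
  have hcone : ∀ N ∈ 𝒩, ∀ hF : IsPolytopeFace (polyhedron E e h) (tightFace E e h N),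
      faceCone (polyhedron E e h) ⟨_, hF⟩ = PointedCone.hull ℝ (e '' (N : Set ι)) :=
    fun N hN hF => H.normalCone_tightFace hN
  have hle : ∀ F G : {F // IsPolytopeFace (polyhedron E e h) F},
      faceCone (polyhedron E e h) F ≤ faceCone (polyhedron E e h) G ↔ G.1 ⊆ F.1 := by
    rintro ⟨F, hF⟩ ⟨G, hG⟩
    obtain ⟨N, hN, rfl⟩ := H.isPolytopeFace_iff.1 hF
    obtain ⟨M, hM, rfl⟩ := H.isPolytopeFace_iff.1 hG
    rw [hcone N hN hF, hcone M hM hG, H.hull_le_iff hM hN, H.tightFace_subset_iff hN hM]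
  refine ⟨H.isCompleteSimplicialFan, ?_, ?_, hle, ?_⟩
  · ext σ
    constructor
    · rintro ⟨⟨F, hF⟩, rfl⟩
      obtain ⟨N, hN, rfl⟩ := H.isPolytopeFace_iff.1 hF
      exact ⟨N, hN, hcone N hN hF⟩
    · rintro ⟨N, hN, rfl⟩
      exact ⟨⟨_, H.isPolytopeFace_iff.2 ⟨N, hN, rfl⟩⟩, hcone N hN _⟩
  · intro F G hFG
    exact Subtype.ext (((hle G F).1 hFG.ge).antisymm ((hle F G).1 hFG.le))
  · rintro ⟨F, hF⟩
    obtain ⟨N, hN, rfl⟩ := H.isPolytopeFace_iff.1 hF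
    rw [hcone N hN hF, H.finrank_span_hull hN, H.card_add_affineDim hN]

end IsTightComplex

/-- A set in the dual of a finite-dimensional space is contained in the convex hull of a finite
set as soon as every vector, seen as a functional on the dual, is bounded on the former by its
value at some point of the latter. -/
theorem subset_convexHull_of_forall_exists_le [FiniteDimensional ℝ V]
    {P s : Set (Module.Dual ℝ V)} (hs : s.Finite)
    (hle : ∀ v : V, ∃ φ ∈ s, ∀ ψ ∈ P, ψ v ≤ φ v) : P ⊆ convexHull ℝ s := by
  intro ψ hψ
  by_contra hnot
  -- Coordinates on `V*` provide the topology in which the convex hull of `s` is closed.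
  let L : Module.Dual ℝ V ≃ₗ[ℝ] (Fin (Module.finrank ℝ (Module.Dual ℝ V)) → ℝ) :=
    (Module.finBasis ℝ (Module.Dual ℝ V)).equivFun
  have himg : L '' convexHull ℝ s = convexHull ℝ (L '' s) :=
    L.toLinearMap.isLinear.image_convexHull s
  have hnot' : L ψ ∉ convexHull ℝ (L '' s) := by
    rw [← himg, L.injective.mem_set_image]
    exact hnot
  obtain ⟨f, u, hfs, hfψ⟩ := geometric_hahn_banach_closed_point (convex_convexHull ℝ (L '' s))
    ((hs.image L).isClosed_convexHull ℝ) hnot'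
  obtain ⟨v, hv⟩ := (Module.evalEquiv ℝ V).surjective (f.toLinearMap ∘ₗ L.toLinearMap)
  have hev : ∀ φ : Module.Dual ℝ V, φ v = f (L φ) := fun φ =>
    LinearMap.congr_fun hv φ
  obtain ⟨φ, hφ, hmax⟩ := hle v
  have h1 := hfs _ (subset_convexHull ℝ _ ⟨φ, hφ, rfl⟩)
  have h2 := hmax ψ hψ
  rw [hev, hev] at h2
  linarith

namespace IsTightComplex

variable {E : Set ι} {e : ι → V} {h : ι → ℝ} {𝒩 : Set (Finset ι)}

theorem isPolytope (H : IsTightComplex E e h 𝒩) [FiniteDimensional ℝ V] :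
    ∃ s : Set (Module.Dual ℝ V), s.Finite ∧ polyhedron E e h = convexHull ℝ s := by
  choose! p hp ht using H.exists_tight
  refine ⟨p '' 𝒩, H.finite_complex.image p, subset_antisymm
    (subset_convexHull_of_forall_exists_le (H.finite_complex.image p) fun v => ?_) ?_⟩
  · obtain ⟨N, hN, c, hc, rfl⟩ := H.exists_comb v
    have hmem : p N ∈ tightFace E e h N :=
      ⟨hp N hN, fun I hI => (ht N hN I (H.subset N hN hI)).2 hI⟩
    rw [← H.maximizers_eq hN hc] at hmem
    exact ⟨p N, ⟨N, hN, rfl⟩, hmem.2⟩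
  · refine convexHull_min ?_ (convex_polyhedron E e h)
    rintro _ ⟨N, hN, rfl⟩
    exact hp N hN

theorem isFullDimSimplePolytope (H : IsTightComplex E e h 𝒩) [FiniteDimensional ℝ V] :
    IsFullDimSimplePolytope (polyhedron E e h) where
  polytope := H.isPolytope
  full_dim := by
    have hne := H.tightFace_nonempty H.empty_mem
    rw [← tightFace_empty,
      AffineSubspace.affineSpan_eq_top_iff_vectorSpan_eq_top_of_nonempty ℝ _ _ hne,
      H.vectorSpan_tightFace H.empty_mem]
    simp
  simple := by
    intro φ hφ
    obtain ⟨N, hN, hφN⟩ := H.isPolytopeFace_iff.1 hφ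
    have hmem : ∀ I, {I} ∈ 𝒩 → (φ ∈ tightFace E e h {I} ↔ I ∈ N) := fun I hI => by
      rw [← Set.singleton_subset_iff, hφN, H.tightFace_subset_iff hI hN,
        Finset.singleton_subset_iff]
    have hsing : ∀ I ∈ N, {I} ∈ 𝒩 := fun I hI =>
      H.mem_of_subset hN (Finset.singleton_subset_iff.2 hI)
    -- The facets through the vertex are the `tightFace {I}` with `I ∈ N`.
    have hfacets : {F | IsPolytopeFacet (polyhedron E e h) F ∧ φ ∈ F}
        = (fun I => tightFace E e h {I}) '' (N : Set ι) := by
      ext F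
      constructor
      · rintro ⟨⟨hF, hdim⟩, hφF⟩
        obtain ⟨M, hM, rfl⟩ := H.isPolytopeFace_iff.1 hF
        have h1 := H.card_add_affineDim hM
        rw [H.affineDim_polyhedron] at hdim
        obtain ⟨I, rfl⟩ := Finset.card_eq_one.1 (show M.card = 1 by omega)
        exact ⟨I, (hmem I hM).1 hφF, rfl⟩
      · rintro ⟨I, hI, rfl⟩
        refine ⟨⟨H.isPolytopeFace_iff.2 ⟨_, hsing I hI, rfl⟩, ?_⟩, (hmem I (hsing I hI)).2 hI⟩
        rw [H.affineDim_polyhedron, ← H.card_add_affineDim (hsing I hI), Finset.card_singleton,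
          add_comm]
    have hinj : Set.InjOn (fun I => tightFace E e h {I}) (N : Set ι) := fun I hI J hJ hIJ =>
      Finset.singleton_injective (H.tightFace_inj (hsing I hI) (hsing J hJ) hIJ)
    rw [hfacets, hinj.ncard_image, Set.ncard_coe_finset, H.affineDim_polyhedron,
      ← H.card_add_affineDim hN, ← hφN, affineDim, vectorSpan_singleton, finrank_bot, add_zero]

end IsTightComplex

end TightSets

/-! ### The right-hand sides `n * 2 ^ (n - 1)` -/

/-- The function `n ↦ n * 2 ^ (n - 1)` governing the inequalities of the polytope. All that matters
is that it grows fast; see `two_pow_mul_growth_lt`. -/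
noncomputable def growth (n : ℕ) : ℝ := n * 2 ^ (n - 1)

theorem growth_zero : growth 0 = 0 := by simp [growth]

theorem growth_one : growth 1 = 1 := by simp [growth]

theorem growth_nonneg (n : ℕ) : 0 ≤ growth n := by unfold growth; positivity

theorem two_pow_mul_growth_lt (m : ℕ) {k : ℕ} (hk : 0 < k) :
    2 ^ k * growth m < growth (m + k) := by
  unfold growth
  have hk' : (0 : ℝ) < k := by exact_mod_cast hk
  rcases Nat.eq_zero_or_pos m with rfl | hm
  · simp only [Nat.cast_zero, zero_mul, mul_zero, zero_add]
    positivity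
  · have h1 : m + k - 1 = k + (m - 1) := by omega
    have h2 : (0 : ℝ) < 2 ^ k * 2 ^ (m - 1) := by positivity
    rw [h1, pow_add]
    push_cast
    nlinarith [mul_pos hk' h2]

theorem growth_mono : Monotone growth := by
  refine monotone_nat_of_le_succ fun n => ?_
  have h1 := two_pow_mul_growth_lt n one_pos
  linarith [growth_nonneg n]

theorem growth_add_lt_of_lt {a b n : ℕ} (ha : a < n) (hb : b < n) :
    growth a + growth b < growth n := by
  obtain ⟨n, rfl⟩ : ∃ k, n = k + 1 := ⟨n - 1, by omega⟩
  have h1 := two_pow_mul_growth_lt n one_pos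
  have h2 := growth_mono (Nat.lt_succ_iff.1 ha)
  have h3 := growth_mono (Nat.lt_succ_iff.1 hb)
  linarith

theorem growth_add_lt {a b : ℕ} (ha : 0 < a) (hb : 0 < b) :
    growth a + growth b < growth (a + b) :=
  growth_add_lt_of_lt (by omega) (by omega)

theorem growth_add_le (a b : ℕ) : growth a + growth b ≤ growth (a + b) := by
  rcases Nat.eq_zero_or_pos a with rfl | ha
  · simp [growth_zero]
  rcases Nat.eq_zero_or_pos b with rfl | hb
  · simp [growth_zero]
  exact (growth_add_lt ha hb).le

theorem add_le_mul_two_pow {j : ℕ} (hj : 0 < j) (d : ℕ) : ((j + d : ℕ) : ℝ) ≤ j * 2 ^ d := by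
  have h1 : d + 1 ≤ 2 ^ d := Nat.lt_two_pow_self
  have h2 : j + d ≤ j * 2 ^ d := by nlinarith
  exact_mod_cast h2

/-- A set of size `n = j + d + q` consists of `q` points of total weight `F` and `j + d` further
points sharing the remaining weight `growth n - F` equally. Then `j` of the latter together with
the former weigh more than `growth (j + q)`. -/
theorem growth_lt_share_add {j d : ℕ} (hj : 0 < j) (hd : 0 < d) (q : ℕ) {F : ℝ} (hF : 0 ≤ F) :
    growth (j + q) < j * ((growth (j + d + q) - F) / (j + d : ℕ)) + F := by
  have hp : (0 : ℝ) < (j + d : ℕ) := by exact_mod_cast Nat.add_pos_left hj d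
  have hj' : (0 : ℝ) < j := by exact_mod_cast hj
  have h1 := two_pow_mul_growth_lt (j + q) hd
  rw [show j + q + d = j + d + q by omega] at h1
  have h2 := mul_le_mul_of_nonneg_right (add_le_mul_two_pow hj d) (growth_nonneg (j + q))
  have h3 : (j : ℝ) * F ≤ (j + d : ℕ) * F :=
    mul_le_mul_of_nonneg_right (by exact_mod_cast Nat.le_add_right j d) hF
  have h4 := mul_lt_mul_of_pos_left h1 hj'
  have h5 : (j : ℝ) * ((growth (j + d + q) - F) / (j + d : ℕ)) + F
      = (j * (growth (j + d + q) - F) + (j + d : ℕ) * F) / (j + d : ℕ) := by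
    field_simp
  rw [h5, lt_div_iff₀ hp]
  linarith

/-- In the situation of `growth_lt_share_add`, if the weight of the `q` points is at most
`growth q`, then `j` of the remaining points alone weigh more than `growth (j + r)` for `r < q`. -/
theorem growth_lt_share {j : ℕ} (hj : 0 < j) (d : ℕ) {q r : ℕ} (hr : r < q) {F : ℝ}
    (hF : F ≤ growth q) :
    growth (j + r) < j * ((growth (j + d + q) - F) / (j + d : ℕ)) := by
  have hp : (0 : ℝ) < (j + d : ℕ) := by exact_mod_cast Nat.add_pos_left hj d
  have hj' : (0 : ℝ) < j := by exact_mod_cast hj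
  have h0 : growth q + growth q < growth (j + d + q) :=
    growth_add_lt_of_lt (by omega) (by omega)
  have h1 := two_pow_mul_growth_lt (j + r) (k := d + 1) (by omega)
  have h1' : growth (j + r + (d + 1)) ≤ growth (j + d + q) := growth_mono (by omega)
  have h2 := mul_le_mul_of_nonneg_right (add_le_mul_two_pow hj d) (growth_nonneg (j + r))
  rw [← mul_div_assoc, lt_div_iff₀ hp]
  have h3 : j * (2 * 2 ^ d * growth (j + r)) < j * (2 * (growth (j + d + q) - F)) := by
    refine mul_lt_mul_of_pos_left ?_ hj'
    rw [pow_succ] at h1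
    linarith
  linarith

/-! ### Nested families and components of a building set -/

namespace BuildingSet

open Finset

variable {S : Type*} [DecidableEq S] (B : BuildingSet S)

/-- A family of members of `B` that satisfies the union condition for nested sets; unlike for
nested sets, maximal members of `B` are allowed. -/
def IsNestedFamily (M : Finset (Finset S)) : Prop :=
  (M : Set (Finset S)) ⊆ B.sets ∧
    ∀ T ⊆ M, 2 ≤ T.card → IsAntichain (· ⊆ ·) (T : Set (Finset S)) → T.biUnion id ∉ B.sets

variable {B}

theorem IsNested.isNestedFamily {N : Finset (Finset S)} (hN : B.IsNested N) :
    B.IsNestedFamily N :=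
  ⟨fun _ hI => (hN.1 hI).1, hN.2⟩

theorem IsNestedFamily.subset {M N : Finset (Finset S)} (hN : B.IsNestedFamily N) (hMN : M ⊆ N) :
    B.IsNestedFamily M :=
  ⟨fun _ hI => hN.1 (hMN hI), fun T hT => hN.2 T (hT.trans hMN)⟩

theorem isNestedFamily_empty : B.IsNestedFamily ∅ := by
  refine ⟨by simp, fun T hT hcard => ?_⟩
  rw [subset_empty.1 hT] at hcard
  simp at hcard

theorem union_biUnion_mem {J : Finset S} (hJ : J ∈ B.sets) (T : Finset (Finset S))
    (hT : ∀ K ∈ T, K ∈ B.sets) (hJT : ∀ K ∈ T, (J ∩ K).Nonempty) :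
    J ∪ T.biUnion id ∈ B.sets := by
  induction T using Finset.induction_on with
  | empty => simpa using hJ
  | insert K T hK ih =>
    have h1 := ih (fun L hL => hT L (mem_insert_of_mem hL))
      (fun L hL => hJT L (mem_insert_of_mem hL))
    have h2 := B.union_mem _ h1 K (hT K (mem_insert_self K T))
      ((hJT K (mem_insert_self K T)).mono (inter_subset_inter_right subset_union_left))
    rwa [union_assoc, union_comm (T.biUnion id), ← id_eq K, ← biUnion_insert] at h2

theorem IsNestedFamily.laminar {M : Finset (Finset S)} (hM : B.IsNestedFamily M) {I J : Finset S}
    (hI : I ∈ M) (hJ : J ∈ M) : I ⊆ J ∨ J ⊆ I ∨ Disjoint I J := by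
  by_contra! hcon
  obtain ⟨h1, h2, h3⟩ := hcon
  have hne : I ≠ J := fun h => h1 h.subset
  refine hM.2 {I, J} (by simp [insert_subset_iff, hI, hJ]) (card_pair hne).ge ?_ ?_
  · rw [coe_pair]
    exact isAntichain_insert.2 ⟨Set.subsingleton_singleton.isAntichain _, fun _ hb _ =>
      hb ▸ ⟨h1, h2⟩⟩
  · rw [biUnion_insert, singleton_biUnion]
    exact B.union_mem I (hM.1 hI) J (hM.1 hJ) (not_disjoint_iff_nonempty_inter.1 h3)

/-- A member of `B` covered by sets of a nested family is contained in one of them: the maximal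
ones among those that it meets have union in `B`. -/
theorem IsNestedFamily.exists_superset {M : Finset (Finset S)} (hM : B.IsNestedFamily M)
    {J : Finset S} (hJ : J ∈ B.sets) (hJM : J ⊆ M.biUnion id) : ∃ K ∈ M, J ⊆ K := by
  classical
  let M' := M.filter fun K => (J ∩ K).Nonempty
  let T := M'.filter fun K => Maximal (· ∈ M') K
  have hTM : T ⊆ M := (filter_subset _ _).trans (filter_subset _ _)
  have hTmeet : ∀ K ∈ T, (J ∩ K).Nonempty := fun K hK =>
    (mem_filter.1 (mem_filter.1 hK).1).2
  have hcover : J ⊆ T.biUnion id := by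
    intro x hx
    obtain ⟨K, hK, hxK⟩ := mem_biUnion.1 (hJM hx)
    obtain ⟨L, hKL, hL⟩ := M'.exists_le_maximal
      (mem_filter.2 ⟨hK, x, mem_inter.2 ⟨hx, hxK⟩⟩)
    exact mem_biUnion.2 ⟨L, mem_filter.2 ⟨hL.1, hL⟩, hKL hxK⟩
  have hanti : IsAntichain (· ⊆ ·) (T : Set (Finset S)) := by
    intro K hK L hL hne hKL
    exact hne (hKL.antisymm ((mem_filter.1 hK).2.2 (mem_filter.1 hL).1 hKL))
  have hunion := union_biUnion_mem hJ T (fun K hK => hM.1 (hTM hK)) hTmeet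
  rw [union_eq_right.2 hcover] at hunion
  have hcard : T.card < 2 := by
    by_contra! h2
    exact hM.2 T hTM h2 hanti hunion
  have hne : T.Nonempty := by
    obtain ⟨x, hx⟩ := B.nonempty_of_mem J hJ
    obtain ⟨K, hK, -⟩ := mem_biUnion.1 (hcover hx)
    exact ⟨K, hK⟩
  obtain ⟨K, hK⟩ := card_eq_one.1 (show T.card = 1 by have := hne.card_pos; omega)
  rw [hK, singleton_biUnion] at hcover
  exact ⟨K, hTM (hK ▸ mem_singleton_self K), hcover⟩

theorem indicatorVec_apply (I : Finset S) (i : S) :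
    indicatorVec I i = if i ∈ I then 1 else 0 := by
  simp [indicatorVec, Finset.sum_apply, Pi.single_apply]

section Components

variable [Fintype S]

open Classical in
variable (B) in
/-- The maximal members of `B` among those contained in `U`, i.e. the components of the
restriction of `B` to `U`. -/
noncomputable def componentsIn (U : Finset S) : Finset (Finset S) :=
  univ.filter fun K => Maximal (fun I => I ∈ B.sets ∧ I ⊆ U) K

theorem mem_componentsIn {U K : Finset S} :
    K ∈ B.componentsIn U ↔ Maximal (fun I => I ∈ B.sets ∧ I ⊆ U) K := by
  simp [componentsIn]

theorem mem_componentsIn_univ {K : Finset S} : K ∈ B.componentsIn univ ↔ K ∈ B.components := by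
  simp [mem_componentsIn, components]

theorem exists_componentsIn_superset {I U : Finset S} (hI : I ∈ B.sets) (hIU : I ⊆ U) :
    ∃ K ∈ B.componentsIn U, I ⊆ K := by
  obtain ⟨K, hIK, hK⟩ := Finite.exists_le_maximal
    (p := fun I => I ∈ B.sets ∧ I ⊆ U) ⟨hI, hIU⟩
  exact ⟨K, mem_componentsIn.2 hK, hIK⟩

theorem componentsIn_eq_of_mem {U K L : Finset S} (hK : K ∈ B.componentsIn U)
    (hL : L ∈ B.componentsIn U) {i : S} (hiK : i ∈ K) (hiL : i ∈ L) : K = L := by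
  rw [mem_componentsIn] at hK hL
  have hKL : K ∪ L ∈ B.sets ∧ K ∪ L ⊆ U :=
    ⟨B.union_mem K hK.1.1 L hL.1.1 ⟨i, mem_inter.2 ⟨hiK, hiL⟩⟩, union_subset hK.1.2 hL.1.2⟩
  exact (hK.eq_of_le hKL subset_union_left).trans (hL.eq_of_le hKL subset_union_right).symm

theorem exists_componentsIn_mem {U : Finset S} {i : S} (hi : i ∈ U) :
    ∃ K ∈ B.componentsIn U, i ∈ K := by
  obtain ⟨K, hK, hiK⟩ := exists_componentsIn_superset (B.singleton_mem i)
    (singleton_subset_iff.2 hi)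
  exact ⟨K, hK, singleton_subset_iff.1 hiK⟩

variable (B) in
theorem sum_indicatorVec_componentsIn (U : Finset S) :
    ∑ K ∈ B.componentsIn U, indicatorVec K = indicatorVec U := by
  funext i
  rw [Finset.sum_apply, indicatorVec_apply]
  simp only [indicatorVec_apply]
  split_ifs with hi
  · obtain ⟨K, hK, hiK⟩ := exists_componentsIn_mem (B := B) hi
    rw [sum_eq_single_of_mem K hK, if_pos hiK]
    intro L hL hLK
    exact if_neg fun hiL => hLK (componentsIn_eq_of_mem hL hK hiL hiK)
  · refine sum_eq_zero fun K hK => if_neg fun hiK => hi ?_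
    exact (mem_componentsIn.1 hK).1.2 hiK

/-- If an antichain has union in `B`, this union lies in a single component `K` of `U`; so the
antichain contains no component, unless it is reduced to `K`. -/
theorem IsNestedFamily.union_componentsIn {M : Finset (Finset S)} (hM : B.IsNestedFamily M)
    {U : Finset S} (hMU : ∀ I ∈ M, I ⊆ U) : B.IsNestedFamily (M ∪ B.componentsIn U) := by
  refine ⟨fun I hI => ?_, fun T hT hcard hanti hunion => ?_⟩
  · rcases mem_union.1 hI with hI | hI
    · exact hM.1 hI
    · exact (mem_componentsIn.1 hI).1.1
  · have hTU : T.biUnion id ⊆ U := by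
      refine biUnion_subset.2 fun I hI => ?_
      rcases mem_union.1 (hT hI) with hI | hI
      · exact hMU I hI
      · exact (mem_componentsIn.1 hI).1.2
    obtain ⟨K, hK, hTK⟩ := exists_componentsIn_superset hunion hTU
    have hle : ∀ I ∈ T, I ⊆ K := fun I hI => (subset_biUnion_of_mem id hI).trans hTK
    by_cases hKT : K ∈ T
    · have : T ⊆ {K} := fun I hI => by
        rw [mem_singleton]
        by_contra hne
        exact hanti hI hKT hne (hle I hI)
      have := card_le_card this
      rw [card_singleton] at this
      omega
    · refine hM.2 T (fun I hI => ?_) hcard hanti hunion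
      refine (mem_union.1 (hT hI)).resolve_right fun hIU => hKT ?_
      obtain ⟨i, hi⟩ := B.nonempty_of_mem I (mem_componentsIn.1 hIU).1.1
      rwa [← componentsIn_eq_of_mem hIU hK hi (hle I hI hi)]

/-- Subtract from `w` its least positive value on its support `U`, and split the indicator vector of
`U` into those of the components of `U`. -/
theorem exists_nestedFamily_comb (w : S → ℝ) (hw : ∀ i, 0 ≤ w i) :
    ∃ M : Finset (Finset S), B.IsNestedFamily M ∧ (∀ I ∈ M, ∀ i ∈ I, 0 < w i) ∧
      ∃ c : Finset S → ℝ, (∀ I ∈ M, 0 < c I) ∧ w = ∑ I ∈ M, c I • indicatorVec I := by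
  classical
  induction hn : (univ.filter fun i => 0 < w i).card using Nat.strong_induction_on
    generalizing w with
  | _ n ih =>
  set U := univ.filter fun i => 0 < w i with hU
  have hmemU : ∀ i, i ∈ U ↔ 0 < w i := fun i => by simp [hU]
  rcases U.eq_empty_or_nonempty with hemp | hne
  · refine ⟨∅, isNestedFamily_empty, by simp, fun _ => 0, by simp, ?_⟩
    funext i
    have : ¬ 0 < w i := by rw [← hmemU, hemp]; exact notMem_empty i
    simpa using le_antisymm (not_lt.1 this) (hw i)
  · obtain ⟨k, hk, hmin⟩ := exists_min_image U w hne
    have hk0 := (hmemU k).1 hk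
    let w' : S → ℝ := w - w k • indicatorVec U
    have hw'U : ∀ i ∈ U, w' i = w i - w k := fun i hi => by
      simp [w', indicatorVec_apply, hi]
    have hw'0 : ∀ i ∉ U, w' i = w i := fun i hi => by simp [w', indicatorVec_apply, hi]
    have hpos : ∀ i, 0 < w' i → 0 < w i := fun i hi => by
      by_cases hiU : i ∈ U
      · exact (hmemU i).1 hiU
      · rwa [hw'0 i hiU] at hi
    obtain ⟨M, hM, hMw, c, hc, hsum⟩ := ih (univ.filter fun i => 0 < w' i).card
      (by
        rw [← hn]
        refine card_lt_card ⟨fun i hi => ?_, fun hle => ?_⟩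
        · exact (hmemU i).2 (hpos i (mem_filter.1 hi).2)
        · have := (mem_filter.1 (hle hk)).2
          rw [hw'U k hk, sub_self] at this
          exact lt_irrefl 0 this)
      w'
      (fun i => by
        by_cases hi : i ∈ U
        · rw [hw'U i hi]; exact sub_nonneg.2 (hmin i hi)
        · rw [hw'0 i hi]; exact hw i)
      rfl
    have hMU : ∀ I ∈ M, I ⊆ U := fun I hI i hi => (hmemU i).2 (hpos i (hMw I hI i hi))
    refine ⟨M ∪ B.componentsIn U, hM.union_componentsIn hMU, fun I hI i hi => ?_,
      fun I => (if I ∈ M then c I else 0) + (if I ∈ B.componentsIn U then w k else 0),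
      fun I hI => ?_, ?_⟩
    · rcases mem_union.1 hI with hI | hI
      · exact hpos i (hMw I hI i hi)
      · exact (hmemU i).1 ((mem_componentsIn.1 hI).1.2 hi)
    · by_cases h1 : I ∈ M
      · have := hc I h1
        simp only [h1, if_true]
        split_ifs <;> linarith
      · have h2 := (mem_union.1 hI).resolve_left h1
        simpa [h1, h2] using hk0
    · have h1 : w = w' + w k • indicatorVec U := by simp [w']
      refine h1.trans ?_
      rw [hsum, ← B.sum_indicatorVec_componentsIn U, smul_sum]
      simp only [add_smul, ite_smul, zero_smul, sum_add_distrib]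
      rw [sum_ite_mem, sum_ite_mem, inter_eq_right.2 subset_union_left,
        inter_eq_right.2 subset_union_right]

end Components

/-! ### Weights that are tight exactly on a nested family -/

/-- Smaller sets are added to the union last, so that each is either disjoint from the union of the
previous ones or contained in it. -/
theorem sum_biUnion_le_growth {M : Finset (Finset S)}
    (hM : ∀ I ∈ M, ∀ J ∈ M, I ⊆ J ∨ J ⊆ I ∨ Disjoint I J) {y : S → ℝ}
    (hy : ∀ K ∈ M, ∑ i ∈ K, y i ≤ growth K.card) :
    ∑ i ∈ M.biUnion id, y i ≤ growth (M.biUnion id).card := by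
  classical
  induction M using Finset.induction_on_min_value (ι := Finset S) Finset.card with
  | empty => simp [growth_zero]
  | insert K M hK hmin ih =>
    have ih' := ih (fun I hI J hJ => hM I (mem_insert_of_mem hI) J (mem_insert_of_mem hJ))
      (fun J hJ => hy J (mem_insert_of_mem hJ))
    rw [biUnion_insert, id_eq]
    by_cases hsub : K ⊆ M.biUnion id
    · rwa [union_eq_right.2 hsub]
    · have hdisj : Disjoint K (M.biUnion id) := by
        rw [disjoint_biUnion_right]
        intro J hJ
        rcases hM K (mem_insert_self K M) J (mem_insert_of_mem hJ) with h1 | h1 | h1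
        · exact absurd (h1.trans (subset_biUnion_of_mem id hJ)) hsub
        · exact absurd (eq_of_subset_of_card_le h1 (hmin J hJ) ▸ hJ) hK
        · exact h1
      rw [sum_union hdisj, card_union_of_disjoint hdisj]
      exact (add_le_add (hy K (mem_insert_self K M)) ih').trans (growth_add_le _ _)

/-- The weights are built by adding the sets of the family in order of increasing size. When `I` is
added, the weight of the union `D` of the earlier sets contained in `I` is already fixed, and the
rest `growth |I| - y(D)` is distributed equally on the points of `I \ D`. -/
theorem IsNestedFamily.exists_weight {M : Finset (Finset S)} (hM : B.IsNestedFamily M) :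
    ∃ y : S → ℝ, (∀ i, 0 ≤ y i) ∧ (∀ K ∈ M, ∑ i ∈ K, y i = growth K.card) ∧
      ∀ J ∈ B.sets, J ∉ M → (∃ K ∈ M, J ⊆ K) → growth J.card < ∑ i ∈ J, y i := by
  classical
  induction M using Finset.induction_on_max_value (ι := Finset S) Finset.card with
  | empty => exact ⟨fun _ => 0, by simp, by simp, by simp⟩
  | insert I M hIM hmax ih =>
    have hM' := hM.subset (subset_insert I M)
    obtain ⟨y, hy0, hyM, hyJ⟩ := ih hM'
    let D := (M.filter (· ⊆ I)).biUnion id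
    have hDI : D ⊆ I := biUnion_subset.2 fun K hK => (mem_filter.1 hK).2
    have hDM : ∀ J ∈ B.sets, J ⊆ D → ∃ K ∈ M, J ⊆ K := fun J hJ hJD => by
      obtain ⟨K, hK, hJK⟩ := (hM'.subset (filter_subset _ _)).exists_superset hJ hJD
      exact ⟨K, (mem_filter.1 hK).1, hJK⟩
    have hMD : ∀ K ∈ M, Disjoint K (I \ D) := fun K hK => by
      rcases hM.laminar (mem_insert_of_mem hK) (mem_insert_self I M) with h1 | h1 | h1
      · exact disjoint_sdiff.mono_left (subset_biUnion_of_mem id (mem_filter.2 ⟨hK, h1⟩))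
      · exact absurd (eq_of_subset_of_card_le h1 (hmax K hK) ▸ hK) hIM
      · exact h1.mono_right sdiff_subset
    have hI : I ∈ B.sets := hM.1 (mem_insert_self I M)
    have hne : (I \ D).Nonempty := by
      rw [sdiff_nonempty]
      intro hID
      obtain ⟨K, hK, hIK⟩ := hDM I hI hID
      exact hIM (eq_of_subset_of_card_le hIK (hmax K hK) ▸ hK)
    have hFle : ∑ i ∈ D, y i ≤ growth D.card :=
      sum_biUnion_le_growth (fun J hJ K hK => (hM'.subset (filter_subset _ _)).laminar hJ hK)
        fun K hK => (hyM K (mem_filter.1 hK).1).le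
    have hF0 : 0 ≤ ∑ i ∈ D, y i := sum_nonneg fun i _ => hy0 i
    have hcardI : I.card = (I \ D).card + D.card := (card_sdiff_add_card_eq_card hDI).symm
    let y₀ := (growth I.card - ∑ i ∈ D, y i) / (I \ D).card
    have hy₀ : 0 ≤ y₀ :=
      div_nonneg (sub_nonneg.2 (hFle.trans (growth_mono (card_le_card hDI)))) (Nat.cast_nonneg _)
    let y' : S → ℝ := fun i => if i ∈ I \ D then y₀ else y i
    have hy'disj : ∀ K, Disjoint K (I \ D) → ∑ i ∈ K, y' i = ∑ i ∈ K, y i := fun K hK =>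
      sum_congr rfl fun i hi => if_neg (disjoint_left.1 hK hi)
    have hy'I : ∀ J ⊆ I, ∑ i ∈ J, y' i = (J \ D).card * y₀ + ∑ i ∈ J ∩ D, y i := fun J hJ => by
      rw [← sum_sdiff (inter_subset_left : J ∩ D ⊆ J), sdiff_inter_self_left,
        hy'disj (J ∩ D) (disjoint_sdiff.mono_left inter_subset_right)]
      congr 1
      rw [sum_congr rfl fun i hi => if_pos (sdiff_subset_sdiff hJ (Subset.refl D) hi),
        sum_const, nsmul_eq_mul]
    refine ⟨y', fun i => ?_, fun K hK => ?_, fun J hJ hJM hJK => ?_⟩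
    · change 0 ≤ if i ∈ I \ D then y₀ else y i
      split_ifs
      · exact hy₀
      · exact hy0 i
    · rcases mem_insert.1 hK with rfl | hK
      · have hp : ((K \ D).card : ℝ) ≠ 0 := by exact_mod_cast hne.card_pos.ne'
        rw [hy'I K (Subset.refl K), inter_eq_right.2 hDI, mul_div_cancel₀ _ hp, sub_add_cancel]
      · rw [hy'disj K (hMD K hK), hyM K hK]
    · by_cases hex : ∃ K ∈ M, J ⊆ K
      · obtain ⟨K, hK, hJK'⟩ := hex
        rw [hy'disj J ((hMD K hK).mono_left hJK')]
        exact hyJ J hJ (fun h1 => hJM (mem_insert_of_mem h1)) ⟨K, hK, hJK'⟩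
      · have hJI : J ⊆ I := by
          obtain ⟨K, hK, hJK'⟩ := hJK
          rcases mem_insert.1 hK with rfl | hK
          · exact hJK'
          · exact absurd ⟨K, hK, hJK'⟩ hex
        have hj : 0 < (J \ D).card := by
          rw [card_pos, sdiff_nonempty]
          exact fun hJD => hex (hDM J hJ hJD)
        have hp : (I \ D).card = (J \ D).card + ((I \ D) \ (J \ D)).card := by
          rw [add_comm]
          exact (card_sdiff_add_card_eq_card (sdiff_subset_sdiff hJI (Subset.refl D))).symm
        have hcardJ : J.card = (J \ D).card + (J ∩ D).card := (card_sdiff_add_card_inter J D).symm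
        rw [hy'I J hJI, hcardJ]
        by_cases hDJ : D ⊆ J
        · rw [inter_eq_right.2 hDJ]
          have hd : 0 < ((I \ D) \ (J \ D)).card := by
            rw [card_pos, sdiff_nonempty]
            intro hle
            refine hJM (mem_insert.2 (Or.inl (hJI.antisymm fun i hi => ?_)))
            by_cases hiD : i ∈ D
            · exact hDJ hiD
            · exact (mem_sdiff.1 (hle (mem_sdiff.2 ⟨hi, hiD⟩))).1
          have := growth_lt_share_add hj hd D.card hF0
          rwa [← hp, ← hcardI] at this
        · have hr : (J ∩ D).card < D.card :=
            card_lt_card ⟨inter_subset_right, fun hle => hDJ fun i hi => (mem_inter.1 (hle hi)).1⟩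
          have := growth_lt_share hj ((I \ D) \ (J \ D)).card hr hFle
          rw [← hp, ← hcardI] at this
          have h0 : 0 ≤ ∑ i ∈ J ∩ D, y i := sum_nonneg fun i _ => hy0 i
          exact this.trans_le (le_add_of_nonneg_right h0)

/-- Since `growth` is superadditive and more than doubles at each step, weights that are at least
`growth` on `B` cannot be tight on two crossing sets, nor on disjoint sets with union in `B`. -/
theorem biUnion_notMem_of_tight {y : S → ℝ} (hy : ∀ I ∈ B.sets, growth I.card ≤ ∑ i ∈ I, y i)
    {T : Finset (Finset S)} (hTB : ∀ I ∈ T, I ∈ B.sets) (hcard : 2 ≤ T.card)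
    (hanti : IsAntichain (· ⊆ ·) (T : Set (Finset S)))
    (ht : ∀ I ∈ T, ∑ i ∈ I, y i = growth I.card) : T.biUnion id ∉ B.sets := by
  intro hunion
  have hypos : ∀ i, 0 ≤ y i := fun i => by
    have := hy _ (B.singleton_mem i)
    rw [card_singleton, growth_one, sum_singleton] at this
    linarith
  have hdisj : ∀ I ∈ T, ∀ J ∈ T, I ≠ J → Disjoint I J := by
    intro I hI J hJ hne
    by_contra hnot
    have h1 := hy _ (B.union_mem I (hTB I hI) J (hTB J hJ)
      (not_disjoint_iff_nonempty_inter.1 hnot))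
    have h2 : ∑ i ∈ I ∪ J, y i ≤ ∑ i ∈ I, y i + ∑ i ∈ J, y i := by
      rw [← sum_union_inter]
      exact le_add_of_nonneg_right (sum_nonneg fun i _ => hypos i)
    have h3 : I.card < (I ∪ J).card := card_lt_card
      ⟨subset_union_left, fun h => hanti hJ hI hne.symm (subset_union_right.trans h)⟩
    have h4 : J.card < (I ∪ J).card := card_lt_card
      ⟨subset_union_right, fun h => hanti hI hJ hne (subset_union_left.trans h)⟩
    have h5 := growth_add_lt_of_lt h3 h4
    rw [ht I hI, ht J hJ] at h2
    linarith
  obtain ⟨I, hI⟩ : T.Nonempty := card_pos.1 (by omega)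
  obtain ⟨J, hJ⟩ : (T.erase I).Nonempty := card_pos.1 (by rw [card_erase_of_mem hI]; omega)
  have hdisjI : Disjoint I ((T.erase I).biUnion id) := by
    rw [disjoint_biUnion_right]
    intro K hK
    exact hdisj I hI K (mem_of_mem_erase hK) (ne_of_mem_erase hK).symm
  have h1 : ∑ i ∈ (T.erase I).biUnion id, y i ≤ growth ((T.erase I).biUnion id).card := by
    refine sum_biUnion_le_growth (fun K hK L hL => ?_) fun K hK => (ht K (mem_of_mem_erase hK)).le
    by_cases hKL : K = L
    · exact Or.inl hKL.subset
    · exact Or.inr (Or.inr (hdisj K (mem_of_mem_erase hK) L (mem_of_mem_erase hL) hKL))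
  have h2 := hy _ hunion
  rw [← insert_erase hI, biUnion_insert, id_eq, sum_union hdisjI, card_union_of_disjoint hdisjI,
    ht I hI] at h2
  have h3 := growth_add_lt (B.nonempty_of_mem I (hTB I hI)).card_pos
    (((B.nonempty_of_mem J (hTB J (mem_of_mem_erase hJ))).mono
      (subset_biUnion_of_mem id hJ)).card_pos)
  linarith

/-! ### The polytope of a building set -/

theorem dual_ebar (φ : Module.Dual ℝ B.Ambient) (I : Finset S) :
    φ (B.ebar I) = ∑ i ∈ I, B.tuple φ i := by
  simp [tuple, ebar, indicatorVec, map_sum]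

theorem ebar_eq_zero {C : Finset S} (hC : C ∈ B.components) : B.ebar C = 0 := by
  rw [ebar, Submodule.mkQ_apply, Submodule.Quotient.mk_eq_zero]
  exact Submodule.subset_span ⟨C, hC, rfl⟩

theorem sum_translation {g : S → ℝ}
    (hg : ∀ C ∈ B.components, ∀ i ∈ C, g i = (2 : ℝ) ^ (C.card - 1)) {I C : Finset S}
    (hC : C ∈ B.components) (hIC : I ⊆ C) :
    ∑ i ∈ I, g i = I.card * (2 : ℝ) ^ (C.card - 1) := by
  rw [sum_congr rfl fun i hi => hg C hC i (hIC hi), sum_const, nsmul_eq_mul]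

variable [Fintype S]

/-- Adding a large multiple of the all-ones vector, which vanishes in `V`, makes a representative of
`v` nonnegative. -/
theorem exists_nested_comb (v : B.Ambient) :
    ∃ N : Finset (Finset S), B.IsNested N ∧
      ∃ c : Finset S → ℝ, (∀ I ∈ N, 0 < c I) ∧ v = ∑ I ∈ N, c I • B.ebar I := by
  classical
  obtain ⟨w, rfl⟩ := B.componentSpan.mkQ_surjective v
  have hones : B.componentSpan.mkQ (indicatorVec univ) = 0 := by
    rw [← B.sum_indicatorVec_componentsIn, map_sum]
    exact sum_eq_zero fun K hK => ebar_eq_zero (mem_componentsIn_univ.1 hK)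
  obtain ⟨M, hM, -, c, hc, hsum⟩ := exists_nestedFamily_comb (B := B)
    (w + (∑ i, |w i|) • indicatorVec univ) fun i => by
      have h1 := single_le_sum (f := fun i => |w i|) (fun i _ => abs_nonneg _) (mem_univ i)
      have h2 := neg_abs_le (w i)
      simp only [Pi.add_apply, Pi.smul_apply, indicatorVec_apply, mem_univ, if_true, smul_eq_mul,
        mul_one]
      linarith
  refine ⟨M.filter (· ∉ B.components), ⟨fun I hI => ?_, (hM.subset (filter_subset _ _)).2⟩, c,
    fun I hI => hc I (mem_filter.1 hI).1, ?_⟩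
  · exact ⟨hM.1 (mem_filter.1 hI).1, (mem_filter.1 hI).2⟩
  · have h1 := congrArg B.componentSpan.mkQ hsum
    rw [map_add, map_smul, hones, smul_zero, add_zero, map_sum] at h1
    rw [h1, sum_filter]
    refine sum_congr rfl fun I _ => ?_
    rw [map_smul]
    split_ifs with hI
    · exact (congrArg (c I • ·) (ebar_eq_zero hI)).trans (smul_zero _)
    · rfl

variable (B) in
/-- Translating by `g`, which is constant on the components, turns the inequalities of the polytope
into `growth |I| ≤ y(I)` for `I ∈ B`, with equality for the components. -/
theorem exists_translation :
    ∃ g : S → ℝ, ∀ C ∈ B.components, ∀ i ∈ C, g i = (2 : ℝ) ^ (C.card - 1) := by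
  choose C hC hiC using fun i : S => exists_componentsIn_mem (B := B) (mem_univ i)
  refine ⟨fun i => (2 : ℝ) ^ ((C i).card - 1), fun D hD i hi => ?_⟩
  dsimp only
  rw [componentsIn_eq_of_mem (hC i) (mem_componentsIn_univ.2 hD) (hiC i) hi]

theorem isTightComplex_isNested {g : S → ℝ}
    (hg : ∀ C ∈ B.components, ∀ i ∈ C, g i = (2 : ℝ) ^ (C.card - 1)) :
    IsTightComplex (B.sets \ B.components) B.ebar (fun I => ∑ i ∈ I, g i - growth I.card)
      {N | B.IsNested N} where
  finite := Set.toFinite _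
  subset N hN := hN.1
  exists_comb := exists_nested_comb
  exists_tight N hN := by
    obtain ⟨y, -, hyM, hyJ⟩ :=
      (hN.isNestedFamily.union_componentsIn fun I _ => subset_univ I).exists_weight
    obtain ⟨φ, hφ⟩ := (B.mem_range_tuple fun i => g i - y i).2 fun C hC => by
      rw [sum_sub_distrib, sum_translation hg hC (Subset.refl C),
        hyM C (mem_union_right _ (mem_componentsIn_univ.2 hC)), growth, sub_self]
    have hval : ∀ I, φ (B.ebar I) = ∑ i ∈ I, g i - ∑ i ∈ I, y i := fun I => by
      rw [dual_ebar, hφ, sum_sub_distrib]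
    have htight : ∀ I ∈ N, ∑ i ∈ I, y i = growth I.card := fun I hI =>
      hyM I (mem_union_left _ hI)
    have hlt : ∀ I ∈ B.sets \ B.components, I ∉ N → growth I.card < ∑ i ∈ I, y i := by
      intro I hI hIN
      refine hyJ I hI.1 (fun h => ?_) ?_
      · exact (mem_union.1 h).elim hIN fun h1 => hI.2 (mem_componentsIn_univ.1 h1)
      · obtain ⟨K, hK, hIK⟩ := exists_componentsIn_superset hI.1 (subset_univ I)
        exact ⟨K, mem_union_right _ hK, hIK⟩
    refine ⟨φ, fun I hI => ?_, fun I hI => ?_⟩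
    · rw [hval]
      refine sub_le_sub_left ?_ _
      by_cases hIN : I ∈ N
      · exact (htight I hIN).ge
      · exact (hlt I hI hIN).le
    · rw [hval, sub_right_inj]
      refine ⟨fun h => ?_, htight I⟩
      by_contra hIN
      exact (hlt I hI hIN).ne' h
  mem_of_tight φ hφ N hN ht := by
    have hval : ∀ I, φ (B.ebar I) = ∑ i ∈ I, g i - ∑ i ∈ I, (g i - B.tuple φ i) := fun I => by
      rw [dual_ebar, sum_sub_distrib, sub_sub_cancel]
    refine ⟨hN, fun T hT hcard hanti => biUnion_notMem_of_tight
      (y := fun i => g i - B.tuple φ i) (fun I hI => ?_) (fun I hI => (hN (hT hI)).1) hcard hanti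
      fun I hI => ?_⟩
    · by_cases hIC : I ∈ B.components
      · have h1 := hval I
        rw [ebar_eq_zero hIC, map_zero, sum_translation hg hIC (Subset.refl I)] at h1
        exact (sub_eq_zero.1 h1.symm).le
      · have h1 := hφ I ⟨hI, hIC⟩
        rw [hval] at h1
        exact sub_le_sub_iff_left _ |>.1 h1
    · have h1 := ht I (hT hI)
      rw [hval] at h1
      exact sub_right_injective h1

end BuildingSet

theorem theorem6p1 {S : Type*} [Fintype S] [DecidableEq S] [Nonempty S] (B : BuildingSet S) :
    ∃ P : Set (Module.Dual ℝ B.Ambient),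
      IsFullDimSimplePolytope P ∧
      IsNormalFan B.nestedFan P ∧
      B.tuple '' P =
        {x : S → ℝ |
          (∀ C ∈ B.components, ∑ i ∈ C, x i = 0) ∧
          (∀ I ∈ B.sets \ B.components, ∀ C ∈ B.components, I ⊆ C →
            ∑ i ∈ I, x i ≤ (I.card : ℝ) * ((2 : ℝ) ^ (C.card - 1) - (2 : ℝ) ^ (I.card - 1)))} := by
  obtain ⟨g, hg⟩ := B.exists_translation
  have H := BuildingSet.isTightComplex_isNested hg
  have hmem : ∀ φ : Module.Dual ℝ B.Ambient,
      φ ∈ polyhedron (B.sets \ B.components) B.ebar (fun I => ∑ i ∈ I, g i - growth I.card) ↔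
        ∀ I ∈ B.sets \ B.components, ∀ C ∈ B.components, I ⊆ C →
          ∑ i ∈ I, B.tuple φ i
            ≤ (I.card : ℝ) * ((2 : ℝ) ^ (C.card - 1) - (2 : ℝ) ^ (I.card - 1)) := by
    intro φ
    refine forall₂_congr fun I hI => ?_
    rw [BuildingSet.dual_ebar]
    have hbound : ∀ C ∈ B.components, I ⊆ C → ∑ i ∈ I, g i - growth I.card
        = (I.card : ℝ) * ((2 : ℝ) ^ (C.card - 1) - (2 : ℝ) ^ (I.card - 1)) := fun C hC hIC => by
      rw [BuildingSet.sum_translation hg hC hIC, growth, mul_sub]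
    constructor
    · intro h C hC hIC
      rwa [← hbound C hC hIC]
    · intro h
      obtain ⟨C, hC, hIC⟩ := BuildingSet.exists_componentsIn_superset hI.1 (Finset.subset_univ I)
      have hC := BuildingSet.mem_componentsIn_univ.1 hC
      exact (h C hC hIC).trans_eq (hbound C hC hIC).symm
  refine ⟨_, H.isFullDimSimplePolytope, H.isNormalFan, ?_⟩
  ext x
  constructor
  · rintro ⟨φ, hφ, rfl⟩
    exact ⟨(B.mem_range_tuple _).1 ⟨φ, rfl⟩, (hmem φ).1 hφ⟩
  · rintro ⟨hx0, hx⟩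
    obtain ⟨φ, rfl⟩ := (B.mem_range_tuple x).2 hx0
    exact ⟨φ, (hmem φ).2 hx, rfl⟩
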